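/- Let $\sigma>0$. For $n\ge 2$ and $\theta\in\mathbb{R}$ let $y_1,\dots,y_n$ be independent and identically distributed as $N(\theta,\sigma^2)$, and let $P_{n,\theta}$ denote the distribution of the sample. Put $\bar y=n^{-1}\sum_{i=1}^n y_i$ and $\hat\sigma=\bigl((n-1)^{-1}\sum_{i=1}^n(y_i-\bar y)^2\bigr)^{1/2}$. For tuning parameters $\eta_n>0$ define the feasible hard-thresholding estimator $\tilde\theta_H=\bar y\,\mathbf 1(|\bar y|>\hat\sigma\eta_n)$ and the infeasible (known-variance) hard-thresholding estimator $\hat\theta_H=\bar y\,\mathbf 1(|\bar y|>\sigma\eta_n)$. Suppose $\eta_n\to 0$ as $n\to\infty$. Then for every sequence $a_n$ of nonnegative real numbers, with $E_{H,n}=[\tilde\theta_H-\hat\sigma a_n,\ \tilde\theta_H+\hat\sigma a_n]$ and $C_{H,n}=[\hat\theta_H-\sigma a_n,\ \hat\theta_H+\sigma a_n]$, \[ \inf_{\theta\in\mathbb{R}}P_{n,\theta}(\theta\in E_{H,n})-\inf_{\theta\in\mathbb{R}}P_{n,\theta}(\theta\in C_{H,n})\longrightarrow 0\qquad (n\to\infty).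 \] The same holds if $E_{H,n}$ and $C_{H,n}$ are both replaced by the corresponding open intervals, by the corresponding left-open right-closed intervals, or by the corresponding left-closed right-open intervals. -/

import Mathlib

open MeasureTheory ProbabilityTheory Filter Topology

noncomputable section

namespace HardThresholdCI

/-- The law `P_{n,θ,σ}` of a sample `y₁, …, yₙ` of i.i.d. `N(θ, σ²)` variables. -/
def sampleLaw (n : ℕ) (θ σ : ℝ) : Measure (Fin n → ℝ) :=
  Measure.pi fun _ => gaussianReal θ (Real.toNNReal (σ ^ 2))

/-- The arithmetic mean of the data. -/
def sampleMean {n : ℕ} (y : Fin n → ℝ) : ℝ :=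
  (∑ i, y i) / (n : ℝ)

/-- The usual estimator of `σ`: the square root of `(n - 1)⁻¹ ∑ (yᵢ - ȳ)²` (meaningful for
`n ≥ 2`). -/
def sampleSD {n : ℕ} (y : Fin n → ℝ) : ℝ :=
  Real.sqrt (((n : ℝ) - 1)⁻¹ * ∑ i, (y i - sampleMean y) ^ 2)

/-- Hard-thresholding of `x` at level `t`: `x · 1(|x| > t)`. -/
def hardThreshold (t x : ℝ) : ℝ :=
  if t < |x| then x else 0

/-- The feasible hard-thresholding estimator with tuning parameter `η`. -/
def feasibleHard {n : ℕ} (η : ℝ) (y : Fin n → ℝ) : ℝ :=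
  hardThreshold (sampleSD y * η) (sampleMean y)

/-- The infeasible hard-thresholding estimator, which uses the true value of `σ`. -/
def infeasibleHard {n : ℕ} (σ η : ℝ) (y : Fin n → ℝ) : ℝ :=
  hardThreshold (σ * η) (sampleMean y)

/-- The infimum over `θ` of the probability `P_{n,θ,σ}(θ ∈ I)` that the confidence set `I`
covers the true parameter. -/
def infCoverage {n : ℕ} (σ : ℝ) (I : (Fin n → ℝ) → Set ℝ) : ℝ :=
  ⨅ θ : ℝ, (sampleLaw n θ σ).real {y | θ ∈ I y}

/-- The infimal coverage of the feasible interval with end points `θ̃_H ± σ̂ a`; the argument `J`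
(one of `Set.Icc`, `Set.Ioo`, `Set.Ioc`, `Set.Ico`) says which end points are included. -/
def infCoverageFeasible (J : ℝ → ℝ → Set ℝ) (n : ℕ) (σ η a : ℝ) : ℝ :=
  infCoverage σ fun y : Fin n → ℝ =>
    J (feasibleHard η y - sampleSD y * a) (feasibleHard η y + sampleSD y * a)

/-- The infimal coverage of the known-variance interval with end points `θ̂_H ± σ a`; the
argument `J` is as for `infCoverageFeasible`. -/
def infCoverageKnown (J : ℝ → ℝ → Set ℝ) (n : ℕ) (σ η a : ℝ) : ℝ :=
  infCoverage σ fun y : Fin n → ℝ =>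
    J (infeasibleHard σ η y - σ * a) (infeasibleHard σ η y + σ * a)

end HardThresholdCI

end

/-!
The infima are never computed. Let `Z = √n (ȳ - θ) / σ`, which is standard normal, and put
`h = √n η`, `α = √n a`. The known-variance interval uses the scale `S = σ`, the feasible one
`S = σ̂`; both are treated as hard-thresholding intervals with some scale `S` satisfying
`|S / σ - 1| < δ` outside an event of probability at most `p`.

* For every `θ ≥ 0` such an interval covers `θ` as soon as `(1 + δ) h - (1 - δ) α < Z < (1 - δ) α`
  and `S` is good, and for `θ ≤ 0` the same holds with `-Z`; this bounds the infimal coverage from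
  below (`le_infCoverageScale`).
* At a `θ` slightly above `(1 + δ) σ a` the set-to-zero estimator does not cover, so coverage forces
  `(1 - δ) h - (1 + δ) α - δ < Z ≤ (1 + δ) α` when `S` is good; this bounds the infimal coverage
  from above (`infCoverageScale_le`).

The two bounds differ by `O(δ + δ h) + 2 p` uniformly in `α`, because multiplying an end point by a
factor near `1` changes a standard normal probability little at any scale
(`gaussianReal_real_Ioc_le_Ioo_add`). Chebyshev's inequality gives `p = O(1 / (n δ²))` for
`S = σ̂` (`sampleLaw_real_le_abs_sampleSD_sub`). With `δ = M / √n` this is `O(1 / M²)`, while `δ → 0`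
and `δ h = M η → 0`; this is where `η → 0` is used. Which end points are included does not matter,
since the first bound holds for open and the second for closed intervals.
-/

noncomputable section

namespace HardThresholdCI

/-! ### The standard normal law of short intervals -/

lemma gaussianPDFReal_zero_one_le_one (x : ℝ) : gaussianPDFReal 0 1 x ≤ 1 := by
  have h1 : (√(2 * Real.pi * ((1 : NNReal) : ℝ)))⁻¹ ≤ 1 := by
    apply inv_le_one_of_one_le₀
    rw [Real.one_le_sqrt]
    have := Real.pi_gt_three
    push_cast
    linarith
  have h2 : Real.exp (-(x - 0) ^ 2 / (2 * ((1 : NNReal) : ℝ))) ≤ 1 := by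
    rw [Real.exp_le_one_iff]
    push_cast
    nlinarith [sq_nonneg x]
  rw [gaussianPDFReal_def]
  exact mul_le_one₀ h1 (Real.exp_pos _).le h2

lemma abs_mul_gaussianPDFReal_zero_one_le_one (x : ℝ) : |x| * gaussianPDFReal 0 1 x ≤ 1 := by
  have h1 : (√(2 * Real.pi * ((1 : NNReal) : ℝ)))⁻¹ ≤ 1 := by
    apply inv_le_one_of_one_le₀
    rw [Real.one_le_sqrt]
    have := Real.pi_gt_three
    push_cast
    linarith
  have h2 : |x| * Real.exp (-(x - 0) ^ 2 / (2 * ((1 : NNReal) : ℝ))) ≤ 1 := by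
    have h3 : |x| ≤ Real.exp (x ^ 2 / 2) := by
      have := Real.add_one_le_exp (x ^ 2 / 2)
      nlinarith [sq_nonneg (|x| - 1), sq_abs x]
    have h4 : -(x - 0) ^ 2 / (2 * ((1 : NNReal) : ℝ)) = -(x ^ 2 / 2) := by push_cast; ring
    rw [h4, Real.exp_neg, ← div_eq_mul_inv]
    exact (div_le_one (Real.exp_pos _)).2 h3
  rw [gaussianPDFReal_def]
  calc |x| * ((√(2 * Real.pi * ((1 : NNReal) : ℝ)))⁻¹ *
        Real.exp (-(x - 0) ^ 2 / (2 * ((1 : NNReal) : ℝ))))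
      = (√(2 * Real.pi * ((1 : NNReal) : ℝ)))⁻¹ *
        (|x| * Real.exp (-(x - 0) ^ 2 / (2 * ((1 : NNReal) : ℝ)))) := by ring
    _ ≤ 1 := mul_le_one₀ h1 (by positivity) h2

lemma gaussianReal_real_Icc_le_mul {p q C : ℝ} (hpq : p ≤ q) (hC : 0 ≤ C)
    (h : ∀ x ∈ Set.Icc p q, gaussianPDFReal 0 1 x ≤ C) :
    (gaussianReal 0 1).real (Set.Icc p q) ≤ C * (q - p) := by
  have h1 : gaussianReal 0 1 (Set.Icc p q) ≤ ENNReal.ofReal (C * (q - p)) := by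
    rw [gaussianReal_apply 0 one_ne_zero]
    calc ∫⁻ x in Set.Icc p q, gaussianPDF 0 1 x
        ≤ ∫⁻ _ in Set.Icc p q, ENNReal.ofReal C :=
          setLIntegral_mono measurable_const fun x hx => ENNReal.ofReal_le_ofReal (h x hx)
      _ = ENNReal.ofReal (C * (q - p)) := by
          rw [setLIntegral_const, Real.volume_Icc, ENNReal.ofReal_mul hC]
  exact ENNReal.toReal_le_of_le_ofReal (mul_nonneg hC (by linarith)) h1

lemma gaussianReal_real_Icc_le_sub {p q : ℝ} (hpq : p ≤ q) :
    (gaussianReal 0 1).real (Set.Icc p q) ≤ q - p := by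
  simpa using gaussianReal_real_Icc_le_mul hpq zero_le_one
    fun x _ => gaussianPDFReal_zero_one_le_one x

/-- An interval at distance at least `b` from `0` has standard normal probability at most its
length divided by `b`, because the density is at most `1 / |x|`. -/
lemma gaussianReal_real_Icc_le_div {p q b : ℝ} (hpq : p ≤ q) (hb : 0 < b)
    (h : ∀ x ∈ Set.Icc p q, b ≤ |x|) :
    (gaussianReal 0 1).real (Set.Icc p q) ≤ (q - p) / b := by
  have := gaussianReal_real_Icc_le_mul (C := 1 / b) hpq (by positivity) fun x hx => by
    rw [le_div_iff₀ hb]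
    calc gaussianPDFReal 0 1 x * b ≤ gaussianPDFReal 0 1 x * |x| :=
          mul_le_mul_of_nonneg_left (h x hx) (gaussianPDFReal_nonneg 0 1 x)
      _ ≤ 1 := by rw [mul_comm]; exact abs_mul_gaussianPDFReal_zero_one_le_one x
  calc _ ≤ 1 / b * (q - p) := this
    _ = (q - p) / b := by ring

/-- Distorting `h` and `α` by factors in `[1 - δ, 1 + δ]`, and shifting the left end point by `δ`,
changes the standard normal probability of the interval from `h - α` to `α` by a multiple of
`δ + δ h`, uniformly in `α`. Distortion by a factor is harmless at any scale because the density
decays faster than `1 / |x|`; only when `α` is at most of the order of `h` does the left end point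
not scale, and then it moves by `O(δ h)`. -/
lemma gaussianReal_real_Ioc_le_Ioo_add {δ h α : ℝ} (hδ : 0 ≤ δ) (hδ' : δ ≤ 1 / 4) (hh : 0 ≤ h)
    (hα : 0 ≤ α) :
    (gaussianReal 0 1).real
        (Set.Ioc ((1 - δ) * h - (1 + δ) * α - δ) ((1 + δ) * α)) ≤
      (gaussianReal 0 1).real (Set.Ioo ((1 + δ) * h - (1 - δ) * α) ((1 - δ) * α)) +
        (29 * δ + 6 * (δ * h)) := by
  set x := (1 - δ) * h - (1 + δ) * α with hx
  set x' := (1 + δ) * h - (1 - δ) * α with hx'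
  set y := (1 + δ) * α with hy
  set y' := (1 - δ) * α with hy'
  have hδh : 0 ≤ δ * h := mul_nonneg hδ hh
  have hδα : 0 ≤ δ * α := mul_nonneg hδ hα
  -- The three closed intervals are what the distortion can add: the shift, the move of the left end
  -- point and the move of the right one.
  have hsub : Set.Ioc (x - δ) y ⊆
      ((Set.Icc (x - δ) x ∪ Set.Icc x x') ∪ Set.Icc y' y) ∪ Set.Ioo x' y' := by
    rintro z ⟨h1, h2⟩
    by_cases h3 : z ≤ x
    · exact Or.inl (Or.inl (Or.inl ⟨h1.le, h3⟩))
    by_cases h4 : z ≤ x'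
    · exact Or.inl (Or.inl (Or.inr ⟨(not_le.1 h3).le, h4⟩))
    by_cases h5 : y' ≤ z
    · exact Or.inl (Or.inr ⟨h5, h2⟩)
    · exact Or.inr ⟨not_le.1 h4, not_le.1 h5⟩
  have b1 : (gaussianReal 0 1).real (Set.Icc (x - δ) x) ≤ δ := by
    simpa using gaussianReal_real_Icc_le_sub (p := x - δ) (q := x) (by linarith)
  have hxx' : x ≤ x' := by rw [hx, hx']; linarith
  have b2 : (gaussianReal 0 1).real (Set.Icc x x') ≤ 24 * δ + 6 * (δ * h) := by
    rcases le_or_gt α (2 * h) with hc | hc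
    · have h1 := gaussianReal_real_Icc_le_sub hxx'
      have h2 : δ * α ≤ δ * (2 * h) := mul_le_mul_of_nonneg_left hc hδ
      have h3 : x' - x = 2 * (δ * h) + 2 * (δ * α) := by rw [hx, hx']; ring
      linarith
    -- Here the interval lies to the left of `-α / 8` and has length `O(δ α)`.
    · have hα' : 0 < α := by linarith
      have h4 : x' ≤ -(α / 8) := by rw [hx']; nlinarith
      have h1 := gaussianReal_real_Icc_le_div hxx' (b := α / 8) (by positivity) fun z hz => by
        have := neg_abs_le z
        linarith [hz.2]
      have h2 : (x' - x) / (α / 8) ≤ 24 * δ := by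
        rw [div_le_iff₀ (by positivity), hx, hx']
        nlinarith
      linarith
  have b3 : (gaussianReal 0 1).real (Set.Icc y' y) ≤ 4 * δ := by
    have hyy : y' ≤ y := by rw [hy, hy']; linarith
    rcases hα.eq_or_lt with h0 | hα'
    · have := gaussianReal_real_Icc_le_sub hyy
      have h3 : y - y' = 0 := by rw [hy, hy', ← h0]; ring
      linarith
    · have h1 := gaussianReal_real_Icc_le_div hyy (b := α / 2) (by positivity) fun z hz => by
        have := le_abs_self z
        have h5 : α / 2 ≤ y' := by rw [hy']; nlinarith
        linarith [hz.1]
      have h2 : (y - y') / (α / 2) ≤ 4 * δ := by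
        rw [div_le_iff₀ (by positivity), hy, hy']
        nlinarith
      linarith
  have := measureReal_mono (μ := gaussianReal 0 1) hsub
  have u1 := measureReal_union_le (μ := gaussianReal 0 1)
    ((Set.Icc (x - δ) x ∪ Set.Icc x x') ∪ Set.Icc y' y) (Set.Ioo x' y')
  have u2 := measureReal_union_le (μ := gaussianReal 0 1)
    (Set.Icc (x - δ) x ∪ Set.Icc x x') (Set.Icc y' y)
  have u3 := measureReal_union_le (μ := gaussianReal 0 1) (Set.Icc (x - δ) x) (Set.Icc x x')
  linarith

/-! ### Standardizing the sample -/

/-- The law of `n` independent standard normal variables. -/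
def stdLaw (n : ℕ) : Measure (Fin n → ℝ) := Measure.pi fun _ => gaussianReal 0 1

instance (n : ℕ) : IsProbabilityMeasure (stdLaw n) := by unfold stdLaw; infer_instance

instance (n : ℕ) (θ σ : ℝ) : IsProbabilityMeasure (sampleLaw n θ σ) := by
  unfold sampleLaw; infer_instance

/-- The standardized data `(yᵢ - θ) / σ`. -/
def standardize {n : ℕ} (θ σ : ℝ) (y : Fin n → ℝ) : Fin n → ℝ := fun i => (y i - θ) / σ

/-- The normalized sum `n^{-1/2} ∑ wᵢ`. -/
def normalizedSum {n : ℕ} (w : Fin n → ℝ) : ℝ := (∑ i, w i) / √n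

@[fun_prop]
lemma measurable_normalizedSum {n : ℕ} : Measurable (normalizedSum (n := n)) := by
  unfold normalizedSum; fun_prop

@[fun_prop]
lemma measurable_sampleSD {n : ℕ} : Measurable (sampleSD (n := n)) := by
  unfold sampleSD sampleMean; fun_prop

lemma map_standardize (n : ℕ) (θ : ℝ) {σ : ℝ} (hσ : 0 < σ) :
    (sampleLaw n θ σ).map (standardize θ σ) = stdLaw n := by
  have h1 : (gaussianReal θ (Real.toNNReal (σ ^ 2))).map (fun x => (x - θ) / σ)
      = gaussianReal 0 1 := by
    have : (fun x : ℝ => (x - θ) / σ) = (fun x => x / σ) ∘ fun x => x - θ := rfl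
    rw [this, ← Measure.map_map (by fun_prop) (by fun_prop), gaussianReal_map_sub_const,
      gaussianReal_map_div_const]
    congr 1
    · simp
    · ext
      simp [Real.coe_toNNReal _ (sq_nonneg σ), hσ.ne']
  unfold sampleLaw stdLaw standardize
  rw [Measure.pi_map_pi (f := fun _ x => (x - θ) / σ) (fun _ => by fun_prop)]
  simp_rw [h1]

lemma measurable_standardize (n : ℕ) (θ σ : ℝ) :
    Measurable (standardize θ σ : (Fin n → ℝ) → Fin n → ℝ) := by
  unfold standardize; fun_prop

/-- Probabilities of events about the standardized data do not depend on `θ` and `σ`. -/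
lemma sampleLaw_real_standardize_preimage {n : ℕ} (θ : ℝ) {σ : ℝ} (hσ : 0 < σ)
    {s : Set (Fin n → ℝ)} (hs : MeasurableSet s) :
    (sampleLaw n θ σ).real {y | standardize θ σ y ∈ s} = (stdLaw n).real s := by
  rw [← map_standardize n θ hσ, map_measureReal_apply (measurable_standardize n θ σ) hs]
  rfl

lemma memLp_eval_stdLaw {n : ℕ} (i : Fin n) : MemLp (fun w : Fin n → ℝ => w i) 2 (stdLaw n) :=
  (memLp_id_gaussianReal' 2 (by simp)).comp_measurePreserving (measurePreserving_eval _ i)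

lemma map_normalizedSum {n : ℕ} (hn : n ≠ 0) :
    (stdLaw n).map normalizedSum = gaussianReal 0 1 := by
  have hG : HasGaussianLaw (fun w : Fin n → ℝ => ∑ i, w i) (stdLaw n) := by
    refine iIndepFun.hasGaussianLaw_fun_sum (X := fun i (w : Fin n → ℝ) => w i) (fun i => ?_) ?_
    · constructor
      have := (measurePreserving_eval (fun _ : Fin n => gaussianReal 0 1) i).map_eq
      change IsGaussian (Measure.map (Function.eval i) (Measure.pi fun _ => gaussianReal 0 1))
      rw [this]
      infer_instance
    · exact iIndepFun_pi (X := fun _ => id) (fun _ => aemeasurable_id)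
  have hE : ∫ w, (∑ i, w i) ∂(stdLaw n) = 0 := by
    rw [integral_finsetSum _ fun i _ => (memLp_eval_stdLaw i).integrable (by norm_num)]
    refine Finset.sum_eq_zero fun i _ => ?_
    have := integral_comp_eval (μ := fun _ : Fin n => gaussianReal 0 1) (i := i) (f := id)
      aestronglyMeasurable_id
    simpa [stdLaw] using this
  have hV : Var[fun w : Fin n → ℝ => ∑ i, w i; stdLaw n] = n := by
    have := variance_sum_pi (μ := fun _ : Fin n => gaussianReal 0 1) (X := fun _ => id)
      (fun _ => memLp_id_gaussianReal' 2 (by simp))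
    simp only [variance_id_gaussianReal] at this
    have h2 : (∑ i, fun w : Fin n → ℝ => id (w i)) = fun w => ∑ i, w i := by
      ext w; simp
    rw [h2] at this
    simpa [stdLaw] using this
  have hS := hG.map_eq_gaussianReal
  rw [hE, hV] at hS
  have h3 : (normalizedSum (n := n)) = (fun x => x / √n) ∘ fun w => ∑ i, w i := rfl
  rw [h3, ← Measure.map_map (by fun_prop) (by fun_prop), hS, gaussianReal_map_div_const]
  congr 1
  · simp
  · ext
    simp [hn]

/-! ### Concentration of the sample standard deviation -/

lemma sampleSD_standardize {n : ℕ} (hn : 1 ≤ n) (θ : ℝ) {σ : ℝ} (hσ : 0 < σ) (y : Fin n → ℝ) :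
    sampleSD (standardize θ σ y) = sampleSD y / σ := by
  have hn' : (n : ℝ) ≠ 0 := by positivity
  have hm : sampleMean (standardize θ σ y) = (sampleMean y - θ) / σ := by
    simp only [sampleMean, standardize, ← Finset.sum_div, Finset.sum_sub_distrib]
    simp
    field_simp
  have h1 : ∑ i, (standardize θ σ y i - sampleMean (standardize θ σ y)) ^ 2
      = (∑ i, (y i - sampleMean y) ^ 2) / σ ^ 2 := by
    rw [hm, Finset.sum_div]
    refine Finset.sum_congr rfl fun i _ => ?_
    simp only [standardize]
    field_simp
    ring
  unfold sampleSD
  rw [h1, ← mul_div_assoc, Real.sqrt_div' _ (sq_nonneg σ), Real.sqrt_sq hσ.le]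

lemma sampleSD_nonneg {n : ℕ} (y : Fin n → ℝ) : 0 ≤ sampleSD y := Real.sqrt_nonneg _

lemma sub_one_mul_sampleSD_sq_sub_one {n : ℕ} (hn : 2 ≤ n) (w : Fin n → ℝ) :
    ((n : ℝ) - 1) * (sampleSD w ^ 2 - 1) =
      ∑ i, (w i ^ 2 - 1) - (normalizedSum w ^ 2 - 1) := by
  have hn2 : (2 : ℝ) ≤ n := by exact_mod_cast hn
  have hn1 : (n : ℝ) - 1 ≠ 0 := by linarith
  have hn0 : (n : ℝ) ≠ 0 := by linarith
  have h1 : sampleSD w ^ 2 = ((n : ℝ) - 1)⁻¹ * ∑ i, (w i - sampleMean w) ^ 2 :=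
    Real.sq_sqrt (mul_nonneg (inv_nonneg.2 (by linarith))
      (Finset.sum_nonneg fun i _ => sq_nonneg _))
  have h2 : ∑ i, (w i - sampleMean w) ^ 2 = ∑ i, w i ^ 2 - (∑ i, w i) ^ 2 / n := by
    have : ∀ i, (w i - sampleMean w) ^ 2
        = w i ^ 2 - 2 * sampleMean w * w i + sampleMean w ^ 2 := fun i => by ring
    simp_rw [this, Finset.sum_add_distrib, Finset.sum_sub_distrib, ← Finset.mul_sum]
    simp only [Finset.sum_const, Finset.card_univ, Fintype.card_fin, nsmul_eq_mul, sampleMean]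
    field_simp
    ring
  have h3 : normalizedSum w ^ 2 = (∑ i, w i) ^ 2 / n := by
    rw [normalizedSum, div_pow, Real.sq_sqrt (by linarith)]
  rw [mul_sub, h1, h2, h3, mul_inv_cancel_left₀ hn1]
  simp
  ring

lemma memLp_sq_sub_one_gaussianReal : MemLp (fun x : ℝ => x ^ 2 - 1) 2 (gaussianReal 0 1) := by
  have h1 : MemLp (fun x : ℝ => x ^ 2) 2 (gaussianReal 0 1) := by
    have h4 := memLp_id_gaussianReal' (μ := 0) (v := 1) 4 (by simp)
    have := h4.mul (p := 4) (q := 4) (r := 2) h4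
      (hpqr := ⟨by
        rw [← ENNReal.toReal_eq_toReal_iff' (by simp) (by simp),
          ENNReal.toReal_add (by simp) (by simp)]
        norm_num⟩)
    convert this using 1
    ext x; simp [sq]
  exact h1.sub (memLp_const 1)

lemma integral_sq_sub_one_gaussianReal : ∫ x : ℝ, (x ^ 2 - 1) ∂(gaussianReal 0 1) = 0 := by
  have hint : Integrable (fun x : ℝ => x ^ 2) (gaussianReal 0 1) :=
    (memLp_id_gaussianReal' (μ := 0) (v := 1) 2 (by simp)).integrable_sq
  have h1 : ∫ x : ℝ, x ^ 2 ∂(gaussianReal 0 1) = 1 := by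
    have := variance_eq_integral (μ := gaussianReal 0 1) (X := fun x : ℝ => x) (by fun_prop)
    rw [variance_fun_id_gaussianReal] at this
    simpa using this.symm
  rw [integral_sub hint (integrable_const 1), h1]
  simp

/-- The variance of the square of a standard normal variable, written with the mean `1` of the
square. Only its finiteness matters. -/
def varSq : ℝ := ∫ x : ℝ, (x ^ 2 - 1) ^ 2 ∂(gaussianReal 0 1)

lemma varSq_nonneg : 0 ≤ varSq := integral_nonneg fun _ => sq_nonneg _

lemma memLp_eval_sq_sub_one {n : ℕ} (i : Fin n) :
    MemLp (fun w : Fin n → ℝ => w i ^ 2 - 1) 2 (stdLaw n) :=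
  memLp_sq_sub_one_gaussianReal.comp_measurePreserving (measurePreserving_eval _ i)

lemma memLp_sum_sq_sub_one (n : ℕ) :
    MemLp (fun w : Fin n → ℝ => ∑ i, (w i ^ 2 - 1)) 2 (stdLaw n) :=
  memLp_finsetSum _ fun i _ => memLp_eval_sq_sub_one i

lemma integral_sum_sq_sub_one_sq (n : ℕ) :
    ∫ w : Fin n → ℝ, (∑ i, (w i ^ 2 - 1)) ^ 2 ∂(stdLaw n) = n * varSq := by
  have hV := variance_sum_pi (μ := fun _ : Fin n => gaussianReal 0 1)
    (X := fun _ (x : ℝ) => x ^ 2 - 1) fun _ => memLp_sq_sub_one_gaussianReal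
  have h1 : Var[fun x : ℝ => x ^ 2 - 1; gaussianReal 0 1] = varSq := by
    rw [variance_eq_integral (by fun_prop), integral_sq_sub_one_gaussianReal]
    simp [varSq]
  have hE : ∫ w : Fin n → ℝ, ∑ i, (w i ^ 2 - 1) ∂(stdLaw n) = 0 := by
    rw [integral_finsetSum _ fun i _ => (memLp_eval_sq_sub_one i).integrable (by norm_num)]
    refine Finset.sum_eq_zero fun i _ => ?_
    rw [← integral_sq_sub_one_gaussianReal]
    exact integral_comp_eval (μ := fun _ : Fin n => gaussianReal 0 1) (i := i)
      (f := fun x => x ^ 2 - 1) (by fun_prop)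
  have h2 : (∑ i, fun w : Fin n → ℝ => w i ^ 2 - 1) = fun w => ∑ i, (w i ^ 2 - 1) := by
    ext w; simp
  rw [h2] at hV
  change Var[_; stdLaw n] = _ at hV
  rw [variance_eq_integral (memLp_sum_sq_sub_one n).aestronglyMeasurable.aemeasurable, hE] at hV
  simpa [h1] using hV

/-- The sample standard deviation concentrates at rate `n^{-1/2}`: Chebyshev's inequality for
`(n - 1)(σ̂² - 1) = ∑ (wᵢ² - 1) - (Z² - 1)`, where `Z` is the normalized sum. -/
lemma stdLaw_real_le_abs_sampleSD_sub_one {n : ℕ} (hn : 2 ≤ n) {δ : ℝ} (hδ : 0 < δ) :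
    (stdLaw n).real {w | δ ≤ |sampleSD w - 1|} ≤ 16 * varSq / (n * δ ^ 2) := by
  have hn2 : (2 : ℝ) ≤ n := by exact_mod_cast hn
  have hmp : MeasurePreserving (normalizedSum (n := n)) (stdLaw n) (gaussianReal 0 1) :=
    ⟨measurable_normalizedSum, map_normalizedSum (by omega)⟩
  have hA := (memLp_sum_sq_sub_one n).integrable_sq
  have hB : Integrable (fun w : Fin n → ℝ => (normalizedSum w ^ 2 - 1) ^ 2) (stdLaw n) :=
    (memLp_sq_sub_one_gaussianReal.comp_measurePreserving hmp).integrable_sq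
  have hBE : ∫ w, (normalizedSum w ^ 2 - 1) ^ 2 ∂(stdLaw n) = varSq := by
    rw [varSq, ← map_normalizedSum (n := n) (by omega), integral_map (by fun_prop) (by fun_prop)]
  set f : (Fin n → ℝ) → ℝ := fun w =>
    2 * (∑ i, (w i ^ 2 - 1)) ^ 2 + 2 * (normalizedSum w ^ 2 - 1) ^ 2 with hf
  have hfi : Integrable f (stdLaw n) := (hA.const_mul 2).add (hB.const_mul 2)
  have hfE : ∫ w, f w ∂(stdLaw n) = 2 * (n * varSq) + 2 * varSq := by
    rw [hf, integral_add (hA.const_mul 2) (hB.const_mul 2), integral_const_mul,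
      integral_const_mul, integral_sum_sq_sub_one_sq, hBE]
  have hM := mul_meas_ge_le_integral_of_nonneg (μ := stdLaw n) (f := f)
    (ae_of_all _ fun w => by positivity) hfi (((n : ℝ) / 2 * δ) ^ 2)
  have hsub : {w : Fin n → ℝ | δ ≤ |sampleSD w - 1|} ⊆ {w | ((n : ℝ) / 2 * δ) ^ 2 ≤ f w} := by
    intro w hw
    simp only [Set.mem_ofPred_eq] at hw ⊢
    have h1 : δ ≤ |sampleSD w ^ 2 - 1| := by
      have : sampleSD w ^ 2 - 1 = (sampleSD w - 1) * (sampleSD w + 1) := by ring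
      rw [this, abs_mul]
      have h2 : 1 ≤ |sampleSD w + 1| := by
        rw [abs_of_nonneg (by linarith [sampleSD_nonneg w])]
        linarith [sampleSD_nonneg w]
      nlinarith [abs_nonneg (sampleSD w - 1)]
    have h3 : (n : ℝ) / 2 * δ ≤ |((n : ℝ) - 1) * (sampleSD w ^ 2 - 1)| := by
      rw [abs_mul, abs_of_nonneg (by linarith : (0 : ℝ) ≤ (n : ℝ) - 1)]
      exact mul_le_mul (by linarith) h1 hδ.le (by linarith)
    have h4 := pow_le_pow_left₀ (by positivity) h3 2
    rw [sq_abs, sub_one_mul_sampleSD_sq_sub_one hn] at h4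
    simp only [hf]
    nlinarith [sq_nonneg (∑ i, (w i ^ 2 - 1) + (normalizedSum w ^ 2 - 1))]
  have hle := measureReal_mono (μ := stdLaw n) hsub
  rw [hfE] at hM
  have hpos : 0 < ((n : ℝ) / 2 * δ) ^ 2 := by positivity
  rw [le_div_iff₀ (by positivity)]
  have h5 : ((n : ℝ) / 2 * δ) ^ 2 * (stdLaw n).real {w | δ ≤ |sampleSD w - 1|}
      ≤ 4 * (n * varSq) := by
    have := mul_le_mul_of_nonneg_left hle hpos.le
    have := varSq_nonneg
    nlinarith
  have h6 : (n : ℝ) * ((stdLaw n).real {w | δ ≤ |sampleSD w - 1|} * (n * δ ^ 2))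
      ≤ n * (16 * varSq) := by linarith
  exact le_of_mul_le_mul_left h6 (by linarith)

lemma sampleLaw_real_le_abs_sampleSD_sub {n : ℕ} (hn : 2 ≤ n) (θ : ℝ) {σ δ : ℝ} (hσ : 0 < σ)
    (hδ : 0 < δ) :
    (sampleLaw n θ σ).real {y | δ * σ ≤ |sampleSD y - σ|} ≤ 16 * varSq / (n * δ ^ 2) := by
  refine le_of_eq_of_le ?_ (stdLaw_real_le_abs_sampleSD_sub_one hn hδ)
  rw [← sampleLaw_real_standardize_preimage θ hσ
    (measurableSet_le measurable_const (by fun_prop))]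
  congr 1
  ext y
  have : sampleSD y / σ - 1 = (sampleSD y - σ) / σ := by field_simp
  rw [Set.mem_ofPred_eq, Set.mem_ofPred_eq, Set.mem_ofPred_eq, sampleSD_standardize (by omega) θ hσ,
    this, abs_div, abs_of_pos hσ, le_div_iff₀ hσ]

/-! ### Coverage of hard-thresholding intervals with an approximate scale -/

/-- If the scale `s` is within the factors `1 ± δ` of `σ`, the interval around the hard-thresholding
estimator covers `θ ≥ 0` as soon as `m - θ` lies between `(1 + δ) σ η - (1 - δ) σ a` and
`(1 - δ) σ a`. Whether or not `θ` exceeds `s a` plays no role. -/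
lemma mem_Ioo_hardThreshold {σ δ s η a m θ : ℝ} (hη : 0 < η) (ha : 0 ≤ a)
    (hσ : 0 < σ) (hδ : 0 ≤ δ) (hs : |s - σ| < δ * σ) (hθ : 0 ≤ θ)
    (h1 : (1 + δ) * (σ * η) - (1 - δ) * (σ * a) < m - θ) (h2 : m - θ < (1 - δ) * (σ * a)) :
    θ ∈ Set.Ioo (hardThreshold (s * η) m - s * a) (hardThreshold (s * η) m + s * a) := by
  obtain ⟨hs1, hs2⟩ := abs_lt.1 hs
  have hsa : (1 - δ) * (σ * a) ≤ s * a := by nlinarith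
  have hsη : s * η ≤ (1 + δ) * (σ * η) := by nlinarith
  have hση : 0 < (1 + δ) * (σ * η) := by positivity
  unfold hardThreshold
  split_ifs with hm
  · constructor <;> linarith
  · have := le_abs_self m
    constructor <;> linarith

/-- A sufficiently large `θ` is covered only if the estimator is not set to zero, and then `m - θ`
lies between `(1 - δ) σ η - (1 + δ) σ a - κ` and `(1 + δ) σ a`. -/
lemma sub_mem_Ioc_of_mem_Icc_hardThreshold {σ δ s η a m κ : ℝ} (hη : 0 < η) (ha : 0 ≤ a)
    (hκ : 0 < κ) (hs : |s - σ| < δ * σ)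
    (h : (1 + δ) * (σ * a) + κ ∈
      Set.Icc (hardThreshold (s * η) m - s * a) (hardThreshold (s * η) m + s * a)) :
    m - ((1 + δ) * (σ * a) + κ) ∈
      Set.Ioc ((1 - δ) * (σ * η) - (1 + δ) * (σ * a) - κ) ((1 + δ) * (σ * a)) := by
  obtain ⟨hs1, hs2⟩ := abs_lt.1 hs
  have hsa : s * a ≤ (1 + δ) * (σ * a) := by nlinarith
  have hsη : (1 - δ) * (σ * η) ≤ s * η := by nlinarith
  obtain ⟨h1, h2⟩ := h
  unfold hardThreshold at h1 h2
  split_ifs at h1 h2 with hm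
  · rw [abs_of_pos (by linarith)] at hm
    constructor <;> linarith
  · linarith

lemma hardThreshold_neg (t x : ℝ) : hardThreshold t (-x) = -hardThreshold t x := by
  unfold hardThreshold
  rw [abs_neg]
  split_ifs <;> simp

lemma sampleMean_sub_eq {n : ℕ} (hn : n ≠ 0) (θ : ℝ) {σ : ℝ} (hσ : 0 < σ) (y : Fin n → ℝ) :
    sampleMean y - θ = σ / √n * normalizedSum (standardize θ σ y) := by
  have h0 : (0 : ℝ) < n := by positivity
  have h : √(n : ℝ) * √n = n := Real.mul_self_sqrt h0.le
  simp only [sampleMean, normalizedSum, standardize, ← Finset.sum_div, Finset.sum_sub_distrib]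
  simp only [Finset.sum_const, Finset.card_univ, Fintype.card_fin, nsmul_eq_mul]
  rw [div_mul_div_comm, h]
  field_simp

/-- The normalized error `√n (ȳ - θ) / σ` of the sample mean is standard normal. -/
lemma sampleLaw_real_normalizedSum_mem {n : ℕ} (hn : n ≠ 0) (θ : ℝ) {σ : ℝ} (hσ : 0 < σ)
    {s : Set ℝ} (hs : MeasurableSet s) :
    (sampleLaw n θ σ).real {y | normalizedSum (standardize θ σ y) ∈ s} =
      (gaussianReal 0 1).real s := by
  rw [← map_normalizedSum hn, map_measureReal_apply measurable_normalizedSum hs,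
    ← sampleLaw_real_standardize_preimage θ hσ (measurable_normalizedSum hs)]
  rfl

/-- The infimal coverage of the interval with centre `hardThreshold (S * η) ȳ` and half-length
`S * a`, for an arbitrary scale statistic `S`. -/
def infCoverageScale (J : ℝ → ℝ → Set ℝ) {n : ℕ} (σ η a : ℝ) (S : (Fin n → ℝ) → ℝ) : ℝ :=
  infCoverage σ fun y : Fin n → ℝ =>
    J (hardThreshold (S y * η) (sampleMean y) - S y * a)
      (hardThreshold (S y * η) (sampleMean y) + S y * a)

lemma infCoverage_le {n : ℕ} (σ θ : ℝ) (I : (Fin n → ℝ) → Set ℝ) :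
    infCoverage σ I ≤ (sampleLaw n θ σ).real {y | θ ∈ I y} :=
  ciInf_le ⟨0, by rintro _ ⟨θ, rfl⟩; exact measureReal_nonneg⟩ θ

lemma infCoverageScale_le {J : ℝ → ℝ → Set ℝ} (hJ : ∀ x y, J x y ⊆ Set.Icc x y) {n : ℕ}
    (hn : n ≠ 0) {σ η a δ p : ℝ} (hσ : 0 < σ) (hη : 0 < η) (ha : 0 ≤ a) (hδ : 0 < δ)
    {S : (Fin n → ℝ) → ℝ} (hS : ∀ θ, (sampleLaw n θ σ).real {y | δ * σ ≤ |S y - σ|} ≤ p) :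
    infCoverageScale J σ η a S ≤
      (gaussianReal 0 1).real (Set.Ioc ((1 - δ) * (√n * η) - (1 + δ) * (√n * a) - δ)
        ((1 + δ) * (√n * a))) + p := by
  -- The first term is at least `S a` when `S` is good, so an estimator set to zero misses `θ`; the
  -- second makes this strict and is `δ` on the scale of `Z`.
  set θ := (1 + δ) * (σ * a) + σ / √n * δ with hθ
  set s := Set.Ioc ((1 - δ) * (√n * η) - (1 + δ) * (√n * a) - δ) ((1 + δ) * (√n * a))
  have hsub : {y : Fin n → ℝ | θ ∈ J
        (hardThreshold (S y * η) (sampleMean y) - S y * a)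
        (hardThreshold (S y * η) (sampleMean y) + S y * a)} ⊆
      {y | normalizedSum (standardize θ σ y) ∈ s} ∪ {y | δ * σ ≤ |S y - σ|} := by
    intro y hy
    by_cases hb : δ * σ ≤ |S y - σ|
    · exact Or.inr hb
    · left
      have h := sub_mem_Ioc_of_mem_Icc_hardThreshold hη ha (κ := σ / √n * δ) (by positivity)
        (not_le.1 hb) (hJ _ _ hy)
      rw [← hθ, sampleMean_sub_eq hn θ hσ] at h
      have hc : 0 < σ / √n := by positivity
      have e : ∀ x, σ * x = σ / √n * (√n * x) := fun x => by field_simp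
      obtain ⟨h1, h2⟩ := h
      rw [e η, e a] at h1
      rw [e a] at h2
      constructor
      · refine lt_of_mul_lt_mul_left ?_ hc.le
        linarith
      · refine le_of_mul_le_mul_left ?_ hc
        linarith
  have h1 := measureReal_mono (μ := sampleLaw n θ σ) hsub
  have h2 := h1.trans (measureReal_union_le _ _)
  rw [sampleLaw_real_normalizedSum_mem hn θ hσ measurableSet_Ioc] at h2
  have h3 := (infCoverage_le σ θ _).trans h2
  exact h3.trans (add_le_add le_rfl (hS θ))

lemma le_infCoverageScale {J : ℝ → ℝ → Set ℝ} (hJ : ∀ x y, Set.Ioo x y ⊆ J x y) {n : ℕ}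
    (hn : n ≠ 0) {σ η a δ p : ℝ} (hσ : 0 < σ) (hη : 0 < η) (ha : 0 ≤ a) (hδ : 0 < δ)
    {S : (Fin n → ℝ) → ℝ} (hS : ∀ θ, (sampleLaw n θ σ).real {y | δ * σ ≤ |S y - σ|} ≤ p) :
    (gaussianReal 0 1).real (Set.Ioo ((1 + δ) * (√n * η) - (1 - δ) * (√n * a))
      ((1 - δ) * (√n * a))) - p ≤ infCoverageScale J σ η a S := by
  have hc : 0 < σ / √n := by positivity
  have e : ∀ x, σ * x = σ / √n * (√n * x) := fun x => by field_simp
  set s := Set.Ioo ((1 + δ) * (√n * η) - (1 - δ) * (√n * a)) ((1 - δ) * (√n * a))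
  refine le_ciInf fun θ => ?_
  suffices h : ∃ t : Set ℝ, MeasurableSet t ∧ (gaussianReal 0 1).real t = (gaussianReal 0 1).real s ∧
      {y | normalizedSum (standardize θ σ y) ∈ t} ⊆ {y | θ ∈ J
        (hardThreshold (S y * η) (sampleMean y) - S y * a)
        (hardThreshold (S y * η) (sampleMean y) + S y * a)} ∪ {y | δ * σ ≤ |S y - σ|} by
    obtain ⟨t, ht, hts, hsub⟩ := h
    have h1 := measureReal_mono (μ := sampleLaw n θ σ) hsub
    rw [sampleLaw_real_normalizedSum_mem hn θ hσ ht, hts] at h1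
    have h2 := h1.trans (measureReal_union_le _ _)
    linarith [hS θ]
  rcases le_total 0 θ with hθ | hθ
  · refine ⟨s, measurableSet_Ioo, rfl, fun y hy => ?_⟩
    by_cases hb : δ * σ ≤ |S y - σ|
    · exact Or.inr hb
    · refine Or.inl (hJ _ _ (mem_Ioo_hardThreshold hη ha hσ hδ.le (not_le.1 hb) hθ ?_ ?_))
      · rw [sampleMean_sub_eq hn θ hσ, e η, e a]
        have := mul_lt_mul_of_pos_left hy.1 hc
        linarith
      · rw [sampleMean_sub_eq hn θ hσ, e a]
        have := mul_lt_mul_of_pos_left hy.2 hc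
        linarith
  -- For `θ ≤ 0`, reflect: `-ȳ` and `-θ` are in the situation of the first case.
  · refine ⟨(fun x => -x) ⁻¹' s, measurable_neg measurableSet_Ioo, ?_, fun y hy => ?_⟩
    · rw [← map_measureReal_apply measurable_neg measurableSet_Ioo, gaussianReal_map_neg, neg_zero]
    by_cases hb : δ * σ ≤ |S y - σ|
    · exact Or.inr hb
    · have hD : -sampleMean y - -θ = σ / √n * -normalizedSum (standardize θ σ y) := by
        have := sampleMean_sub_eq hn θ hσ y
        linarith
      have h := mem_Ioo_hardThreshold (m := -sampleMean y) (θ := -θ) hη ha hσ hδ.le (not_le.1 hb)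
        (by linarith)
        (by
          rw [hD, e η, e a]
          have := mul_lt_mul_of_pos_left hy.1 hc
          linarith)
        (by
          rw [hD, e a]
          have := mul_lt_mul_of_pos_left hy.2 hc
          linarith)
      rw [hardThreshold_neg] at h
      refine Or.inl (hJ _ _ ⟨?_, ?_⟩)
      · linarith [h.2]
      · linarith [h.1]

/-- Finite-sample comparison of the two infimal coverages: both lie in the same window, up to the
probability that `σ̂ / σ` is not within `δ` of `1`. -/
lemma abs_infCoverageFeasible_sub_infCoverageKnown_le {J : ℝ → ℝ → Set ℝ}
    (hJ : ∀ x y, Set.Ioo x y ⊆ J x y) (hJ' : ∀ x y, J x y ⊆ Set.Icc x y) {n : ℕ} (hn : 2 ≤ n)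
    {σ η a δ : ℝ} (hσ : 0 < σ) (hη : 0 < η) (ha : 0 ≤ a) (hδ : 0 < δ) (hδ' : δ ≤ 1 / 4) :
    |infCoverageFeasible J n σ η a - infCoverageKnown J n σ η a| ≤
      29 * δ + 6 * (δ * (√n * η)) + 16 * varSq / (n * δ ^ 2) := by
  have hn0 : n ≠ 0 := by omega
  have hF : infCoverageFeasible J n σ η a = infCoverageScale J σ η a (sampleSD (n := n)) := rfl
  have hK : infCoverageKnown J n σ η a = infCoverageScale (n := n) J σ η a fun _ => σ := rfl
  have hSF := fun θ => sampleLaw_real_le_abs_sampleSD_sub hn θ hσ hδ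
  have hSK : ∀ θ, (sampleLaw n θ σ).real {_y | δ * σ ≤ |σ - σ|} ≤ 0 := fun θ => by
    have : ¬ δ * σ ≤ 0 := not_le.2 (by positivity)
    simp [this]
  have u1 := infCoverageScale_le hJ' hn0 hσ hη ha hδ hSF
  have u2 := infCoverageScale_le hJ' hn0 hσ hη ha hδ hSK
  have l1 := le_infCoverageScale hJ hn0 hσ hη ha hδ hSF
  have l2 := le_infCoverageScale hJ hn0 hσ hη ha hδ hSK
  have w := gaussianReal_real_Ioc_le_Ioo_add (h := √n * η) (α := √n * a) hδ.le hδ'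
    (by positivity) (by positivity)
  rw [hF, hK, abs_le]
  constructor <;> linarith

/-- The finite-sample comparison with `δ = M / √n`: the deviation probability is then `O(1 / M²)`
uniformly in `n`, while `δ` and `δ √n η = M η` tend to `0`. -/
lemma tendsto_infCoverageFeasible_sub_infCoverageKnown {J : ℝ → ℝ → Set ℝ}
    (hJ : ∀ x y, Set.Ioo x y ⊆ J x y) (hJ' : ∀ x y, J x y ⊆ Set.Icc x y) {σ : ℝ} (hσ : 0 < σ)
    {η : ℕ → ℝ} (hη_pos : ∀ n, 0 < η n) (hη : Tendsto η atTop (𝓝 0)) {a : ℕ → ℝ}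
    (ha : ∀ n, 0 ≤ a n) :
    Tendsto (fun n : ℕ => infCoverageFeasible J n σ (η n) (a n) -
      infCoverageKnown J n σ (η n) (a n)) atTop (𝓝 0) := by
  rw [Metric.tendsto_atTop']
  intro ε hε
  obtain ⟨M, hM0, hM⟩ : ∃ M : ℝ, 0 < M ∧ 16 * varSq / M ^ 2 < ε / 2 := by
    have h : Tendsto (fun M : ℝ => 16 * varSq / M ^ 2) atTop (𝓝 0) :=
      tendsto_const_nhds.div_atTop (tendsto_pow_atTop two_ne_zero)
    exact ((eventually_gt_atTop 0).and (h.eventually_lt_const (half_pos hε))).exists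
  have hδ : Tendsto (fun n : ℕ => M / √n) atTop (𝓝 0) :=
    tendsto_const_nhds.div_atTop (Real.tendsto_sqrt_atTop.comp tendsto_natCast_atTop_atTop)
  have hb : Tendsto (fun n : ℕ => 29 * (M / √n) + 6 * (M * η n)) atTop (𝓝 0) := by
    simpa using (hδ.const_mul 29).add ((hη.const_mul M).const_mul 6)
  have hev : ∀ᶠ n : ℕ in atTop, 2 ≤ n ∧ M / √n < 1 / 4 ∧
      29 * (M / √n) + 6 * (M * η n) < ε / 2 :=
    (eventually_ge_atTop 2).and ((hδ.eventually_lt_const (by norm_num)).and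
      (hb.eventually_lt_const (half_pos hε)))
  obtain ⟨N, hN⟩ := eventually_atTop.1 hev
  refine ⟨N, fun n hn => ?_⟩
  obtain ⟨h2, h4, h5⟩ := hN n hn.le
  have hn0 : (0 : ℝ) < n := by
    have : 0 < n := by omega
    exact_mod_cast this
  have hr : 0 < √(n : ℝ) := Real.sqrt_pos.2 hn0
  have h := abs_infCoverageFeasible_sub_infCoverageKnown_le hJ hJ' h2 hσ (hη_pos n) (ha n)
    (δ := M / √n) (by positivity) h4.le
  have e1 : M / √n * (√n * η n) = M * η n := by field_simp
  have e2 : (n : ℝ) * (M / √n) ^ 2 = M ^ 2 := by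
    rw [div_pow, Real.sq_sqrt hn0.le]
    field_simp
  rw [e1, e2] at h
  rw [Real.dist_eq, sub_zero]
  linarith

end HardThresholdCI

end

theorem mainTheorem6 (σ : ℝ) (hσ : 0 < σ) (η : ℕ → ℝ) (hη_pos : ∀ n, 0 < η n)
    (hη : Tendsto η atTop (𝓝 0)) (a : ℕ → ℝ) (ha : ∀ n, 0 ≤ a n) :
    Tendsto (fun n : ℕ =>
        HardThresholdCI.infCoverageFeasible Set.Icc n σ (η n) (a n) -
          HardThresholdCI.infCoverageKnown Set.Icc n σ (η n) (a n)) atTop (𝓝 0) ∧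
    Tendsto (fun n : ℕ =>
        HardThresholdCI.infCoverageFeasible Set.Ioo n σ (η n) (a n) -
          HardThresholdCI.infCoverageKnown Set.Ioo n σ (η n) (a n)) atTop (𝓝 0) ∧
    Tendsto (fun n : ℕ =>
        HardThresholdCI.infCoverageFeasible Set.Ioc n σ (η n) (a n) -
          HardThresholdCI.infCoverageKnown Set.Ioc n σ (η n) (a n)) atTop (𝓝 0) ∧
    Tendsto (fun n : ℕ =>
        HardThresholdCI.infCoverageFeasible Set.Ico n σ (η n) (a n) -
          HardThresholdCI.infCoverageKnown Set.Ico n σ (η n) (a n)) atTop (𝓝 0) :=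
  ⟨HardThresholdCI.tendsto_infCoverageFeasible_sub_infCoverageKnown
      (fun _ _ => Set.Ioo_subset_Icc_self) (fun _ _ => subset_rfl) hσ hη_pos hη ha,
    HardThresholdCI.tendsto_infCoverageFeasible_sub_infCoverageKnown
      (fun _ _ => subset_rfl) (fun _ _ => Set.Ioo_subset_Icc_self) hσ hη_pos hη ha,
    HardThresholdCI.tendsto_infCoverageFeasible_sub_infCoverageKnown
      (fun _ _ => Set.Ioo_subset_Ioc_self) (fun _ _ => Set.Ioc_subset_Icc_self) hσ hη_pos hη ha,
    HardThresholdCI.tendsto_infCoverageFeasible_sub_infCoverageKnown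
      (fun _ _ => Set.Ioo_subset_Ico_self) (fun _ _ => Set.Ico_subset_Icc_self) hσ hη_pos hη ha⟩
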